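/- Let $K$ be a global field with ring of integers $R$ (that is, $K$ is a number field and $R$ is the integral closure of $\mathbb{Z}$ in $K$; or $K$ is a finite extension of $\mathbb{F}_q(t)$ for a finite field $\mathbb{F}_q$ and $R$ is the integral closure of $\mathbb{F}_q[t]$ in $K$), and suppose that $R$ is a principal ideal domain. Let $d\ge 2$. Write $M_d(K)$ for the set of pairs $[F,G]$ of homogeneous polynomials of degree $d$ in $K[X,Y]$ whose resultant $\mathrm{Res}_d(F,G)$ as forms of degree $d$ is nonzero. The group $(\mathbb{G}_m\times \mathrm{GL}_2)(K)=K^\times\times\mathrm{GL}_2(K)$ acts on $M_d(K)$ from the right by $$[F,G]^{(\lambda,A)}=\big[\lambda(\delta F'-\beta G'),\ \lambda(-\gamma F'+\alpha G')\big],\qquad A=\begin{pmatrix}\alpha&\beta\\ \gamma&\delta\end{pmatrix},$$ where $F'=F(\alpha X+\beta Y,\gamma X+\delta Y)$ and $G'=G(\alpha X+\beta Y,\gamma X+\delta Y)$. For $[F,G]\in M_d(K)$ defining the rational map $\phi=F/G$, the models of the conjugacy class $[\phi]$ are the elements of the orbit of $[F,G]$; such a model is over $R$ if both its entries lie in $R[X,Y]$.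 Let $\mathrm{Res}_R([\phi])$ be the ideal of $R$ generated by the resultants of all models of $[\phi]$ over $R$. A model $[F_1,G_1]$ of $[\phi]$ over $R$ is called $R$-minimal if $\mathrm{Res}_R([\phi])=\mathrm{Res}_d(F_1,G_1)R$. Let $\mathrm{Min}_R([\phi])$ be the set of $R$-minimal models of $[\phi]$ and put $$\mathrm{MinTran}_R([F,G])=\{(\lambda,A)\in(\mathbb{G}_m\times\mathrm{GL}_2)(K): [F,G]^{(\lambda,A)}\in\mathrm{Min}_R([\phi])\}.$$ The pairs $(c^{-(d+1)},cI)$ with $c\in K^\times$ form a central subgroup $T_d(K)$ of $(\mathbb{G}_m\times\mathrm{GL}_2)(K)$ that acts trivially on $M_d(K)$. If $[F,G]\in M_d(K)$ is an $R$-minimal model of $[\phi]$, then, up to these trivially acting scalars, $\mathrm{MinTran}_R([F,G])$ is a finite union of left cosets of $(\mathbb{G}_m\times\mathrm{GL}_2)(R)$. That is, $\mathrm{MinTran}_R([F,G])$ is the union of finitely many left cosets $g\cdot\big((\mathbb{G}_m\times\mathrm{GL}_2)(R)\,T_d(K)\big)$ with $g\in(\mathbb{G}_m\times\mathrm{GL}_2)(K)$.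 -/

import Mathlib

open scoped Polynomial RatFunc Pointwise

namespace MinimalModels

/-- `R` is the ring of integers of the global field `K`: either `K` is a number field and `R` is the
integral closure of `ℤ` in `K`, or `K` is a finite extension of `𝔽_q(t)` for a finite field `𝔽_q`
and some element `t`, and `R` is the integral closure of `𝔽_q[t]` in `K`. (Every finite field is
isomorphic to one in `Type`.) -/
inductive IsRingOfIntegersOfGlobalField (R K : Type*) [CommRing R] [Field K] [Algebra R K] : Prop
  | numberField [NumberField K] [IsIntegralClosure R ℤ K] :
      IsRingOfIntegersOfGlobalField R K
  | functionField (Fq : Type) [Field Fq] [Finite Fq] [Algebra Fq[X] K] [Algebra Fq⟮X⟯ K]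
      [IsScalarTower Fq[X] Fq⟮X⟯ K] [FunctionField Fq K] [IsIntegralClosure R Fq[X] K] :
      IsRingOfIntegersOfGlobalField R K

section Field

variable {K : Type*} [Field K]

/-- Pairs `[F, G]` of polynomials in the two variables `X = X 0` and `Y = X 1`. -/
abbrev FormPair (K : Type*) [Field K] : Type _ :=
  MvPolynomial (Fin 2) K × MvPolynomial (Fin 2) K

/-- The group `(𝔾_m × GL₂)(K)`. -/
abbrev Trans (K : Type*) [Field K] : Type _ := Kˣ × GL (Fin 2) K

/-- The dehomogenization `f(z) = F(z, 1)`. -/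
noncomputable def dehomog (F : MvPolynomial (Fin 2) K) : K[X] :=
  MvPolynomial.aeval ![Polynomial.X, 1] F

/-- `Res_d(F, G)`: the resultant of `F` and `G` as forms of degree `d`, i.e. the determinant of
the `2d × 2d` Sylvester matrix. -/
noncomputable def res (d : ℕ) (P : FormPair K) : K :=
  Polynomial.resultant (dehomog P.1) (dehomog P.2) d d

/-- `[F, G] ∈ M_d(K)`: two forms of degree `d` with nonvanishing resultant. -/
def IsModel (d : ℕ) (P : FormPair K) : Prop :=
  P.1.IsHomogeneous d ∧ P.2.IsHomogeneous d ∧ res d P ≠ 0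

/-- `F(αX + βY, γX + δY)` for `A = (α, β; γ, δ)`. -/
noncomputable def substForm (A : Matrix (Fin 2) (Fin 2) K) (F : MvPolynomial (Fin 2) K) :
    MvPolynomial (Fin 2) K :=
  MvPolynomial.aeval
    (fun i => MvPolynomial.C (A i 0) * MvPolynomial.X 0 + MvPolynomial.C (A i 1) * MvPolynomial.X 1)
    F

/-- The right action `[F, G]^(λ, A) = [λ F_A, λ G_A]`, where
`[F_A, G_A] = A^adj ∘ [F, G] ∘ A`. -/
noncomputable def act (P : FormPair K) (g : Trans K) : FormPair K :=
  let A : Matrix (Fin 2) (Fin 2) K := g.2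
  (MvPolynomial.C (g.1 : K) *
      (MvPolynomial.C (A 1 1) * substForm A P.1 - MvPolynomial.C (A 0 1) * substForm A P.2),
   MvPolynomial.C (g.1 : K) *
      (-MvPolynomial.C (A 1 0) * substForm A P.1 + MvPolynomial.C (A 0 0) * substForm A P.2))

/-- For a model `P` of `φ`: `Q ∈ M_d(K)` is a model of the conjugacy class `[φ]`, i.e. it lies in
the `(𝔾_m × GL₂)(K)`-orbit of `P`. -/
def IsModelOfClass (d : ℕ) (P Q : FormPair K) : Prop :=
  IsModel d Q ∧ ∃ g : Trans K, Q = act P g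

/-- The homomorphism `c ↦ (c^{-(d+1)}, c I)`. -/
noncomputable def scalarHom (d : ℕ) (K : Type*) [Field K] : Kˣ →* Trans K :=
  (zpowGroupHom (-((d : ℤ) + 1))).prod (Matrix.GeneralLinearGroup.scalar (Fin 2))

/-- The subgroup of the pairs `(c^{-(d+1)}, c I)`, `c ∈ Kˣ`. -/
noncomputable def scalarSubgroup (d : ℕ) (K : Type*) [Field K] : Subgroup (Trans K) :=
  (scalarHom d K).range

end Field

section Integral

variable (R : Type*) [CommRing R] {K : Type*} [Field K] [Algebra R K]

/-- `[F, G]` is over `R`: `F, G ∈ R[X, Y]`. -/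
def IsOver (P : FormPair K) : Prop :=
  P.1 ∈ (MvPolynomial.map (σ := Fin 2) (algebraMap R K)).range ∧
  P.2 ∈ (MvPolynomial.map (σ := Fin 2) (algebraMap R K)).range

/-- `Res_R([φ])` for the class of the map `φ` with model `P`: the ideal of `R` generated by the
resultants of the models of `[φ]` over `R`. -/
noncomputable def resIdeal (d : ℕ) (P : FormPair K) : Ideal R :=
  Ideal.span {r : R | ∃ Q : FormPair K, IsModelOfClass d P Q ∧ IsOver R Q ∧
    algebraMap R K r = res d Q}

/-- `Min_R([φ])` for the class of the map `φ` with model `P`: the models of `[φ]` over `R` whose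
resultant generates `Res_R([φ])`. -/
def minModels (d : ℕ) (P : FormPair K) : Set (FormPair K) :=
  {Q | IsModelOfClass d P Q ∧ IsOver R Q ∧
    ∃ r : R, algebraMap R K r = res d Q ∧ resIdeal R d P = Ideal.span {r}}

/-- `[F, G]` is an `R`-minimal model (of the class that it defines). -/
def IsMinimalModel (d : ℕ) (P : FormPair K) : Prop :=
  IsModel d P ∧ P ∈ minModels R d P

/-- `MinTran_R([F, G])`. -/
def minTran (d : ℕ) (P : FormPair K) : Set (Trans K) :=
  {g | act P g ∈ minModels R d P}

/-- `(𝔾_m × GL₂)(R)` as a subgroup of `(𝔾_m × GL₂)(K)`. -/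
noncomputable def integralSubgroup (K : Type*) [Field K] [Algebra R K] : Subgroup (Trans K) :=
  ((Units.map (algebraMap R K : R →* K)).prodMap
    (Matrix.GeneralLinearGroup.map (n := Fin 2) (algebraMap R K))).range

end Integral

end MinimalModels

/-! Let ρ be the resultant of the minimal model P = [F, G]. Since Res(P^(λ,A)) = λ^{2d}
det(A)^{d²+d} ρ (`res_act`), a pair (λ, A) lies in MinTran exactly when P^(λ,A) is over R and λ^{2d}
det(A)^{d²+d} is a unit of R (`mem_minTran_iff`). As R is a PID, a scalar from T_d makes A integral
with entries generating the unit ideal; as R is integrally closed, λ² det(A)^{d+1} is then itself a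
unit.

The heart is the bound det A ∣ ρ² (`det_dvd_sq_of_isOver_act`). Undoing the adjugate shows that λ
det(A) F(v) and λ det(A) G(v) are integral for each column v of A. Hence products of two of F(v),
G(v) are divisible by det(A)^{d-1}, so by det A because d ≥ 2. The resultant times a power of a
coordinate of v is a combination of F(v) and G(v), and primitivity of A removes the coordinates.

Two such matrices congruent modulo ρ² differ by a factor in GL₂(R), and the λ's then differ by a
unit (`inv_mul_mem_integralSubgroup`). Since R/ρ² is finite, only finitely many cosets occur. -/

namespace MinimalModels

/-! ### Transformation of the resultant under linear substitutions and linear combinations. -/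

section Resultant

variable {K : Type*} [Field K]

lemma substForm_mul (A : Matrix (Fin 2) (Fin 2) K) (F G : MvPolynomial (Fin 2) K) :
    substForm A (F * G) = substForm A F * substForm A G := map_mul _ _ _

lemma substForm_add (A : Matrix (Fin 2) (Fin 2) K) (F G : MvPolynomial (Fin 2) K) :
    substForm A (F + G) = substForm A F + substForm A G := map_add _ _ _

lemma substForm_sub (A : Matrix (Fin 2) (Fin 2) K) (F G : MvPolynomial (Fin 2) K) :
    substForm A (F - G) = substForm A F - substForm A G := map_sub _ _ _

lemma substForm_neg (A : Matrix (Fin 2) (Fin 2) K) (F : MvPolynomial (Fin 2) K) :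
    substForm A (-F) = -substForm A F := map_neg _ _

lemma substForm_C (A : Matrix (Fin 2) (Fin 2) K) (c : K) :
    substForm A (MvPolynomial.C c) = MvPolynomial.C c := by
  simp [substForm]

lemma substForm_X (A : Matrix (Fin 2) (Fin 2) K) (i : Fin 2) :
    substForm A (MvPolynomial.X i) =
      MvPolynomial.C (A i 0) * MvPolynomial.X 0 + MvPolynomial.C (A i 1) * MvPolynomial.X 1 := by
  simp [substForm]

lemma substForm_substForm (A B : Matrix (Fin 2) (Fin 2) K) (F : MvPolynomial (Fin 2) K) :
    substForm B (substForm A F) = substForm (A * B) F := by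
  induction F using MvPolynomial.induction_on with
  | C c => simp only [substForm_C]
  | add p q hp hq => simp only [substForm_add, hp, hq]
  | mul_X p i hp =>
    simp only [substForm_mul, hp, substForm_X, substForm_add, substForm_C, Matrix.mul_apply,
      Fin.sum_univ_two, map_add, map_mul]
    ring

lemma isHomogeneous_substForm (A : Matrix (Fin 2) (Fin 2) K) {F : MvPolynomial (Fin 2) K} {n : ℕ}
    (hF : F.IsHomogeneous n) : (substForm A F).IsHomogeneous n := by
  have := hF.aeval (τ := Fin 2) (fun i => MvPolynomial.C (A i 0) * MvPolynomial.X 0 +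
    MvPolynomial.C (A i 1) * MvPolynomial.X 1) (n := 1) (fun i => by
      refine MvPolynomial.IsHomogeneous.add ?_ ?_ <;>
      exact MvPolynomial.IsHomogeneous.C_mul (MvPolynomial.isHomogeneous_X _ _) _)
  rwa [one_mul] at this

lemma natDegree_dehomog_le {F : MvPolynomial (Fin 2) K} {n : ℕ} (hF : F.IsHomogeneous n) :
    (dehomog F).natDegree ≤ n := by
  rw [dehomog, MvPolynomial.aeval_def, MvPolynomial.eval₂_eq']
  refine Polynomial.natDegree_sum_le_of_forall_le _ _ fun m hm => ?_
  have h := hF (MvPolynomial.mem_support_iff.mp hm)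
  rw [Finsupp.weight_apply, Finsupp.sum_fintype _ _ (by simp)] at h
  simp only [Fin.prod_univ_two, Polynomial.algebraMap_eq, Matrix.cons_val_zero,
    Matrix.cons_val_one, one_pow, mul_one]
  refine (Polynomial.natDegree_C_mul_X_pow_le _ _).trans ?_
  simp [Fin.sum_univ_two] at h
  omega

lemma homogenize_dehomog {F : MvPolynomial (Fin 2) K} {n : ℕ} (hF : F.IsHomogeneous n) :
    (dehomog F).homogenize n = F :=
  Polynomial.homogenize_eq_of_isHomogeneous hF rfl

/-- The action of a matrix on the space of polynomials of degree at most `n`, induced by the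
substitution on forms of degree `n`. -/
noncomputable def substPoly (n : ℕ) (A : Matrix (Fin 2) (Fin 2) K) :
    Polynomial.degreeLT K (n + 1) →ₗ[K] Polynomial.degreeLT K (n + 1) where
  toFun f := ⟨dehomog (substForm A ((f : K[X]).homogenize n)), by
    rw [Polynomial.mem_degreeLT]
    refine (Polynomial.degree_le_of_natDegree_le (natDegree_dehomog_le
      (isHomogeneous_substForm A (Polynomial.isHomogeneous_homogenize _)))).trans_lt ?_
    exact_mod_cast n.lt_succ_self⟩
  map_add' f g := by
    ext1
    simp [dehomog, substForm]
  map_smul' c f := by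
    ext1
    simp [dehomog, substForm]

lemma natDegree_le_of_mem_degreeLT {n : ℕ} (f : Polynomial.degreeLT K (n + 1)) :
    (f : K[X]).natDegree ≤ n := by
  have h := Polynomial.mem_degreeLT.mp f.2
  by_cases hf : (f : K[X]) = 0
  · simp [hf]
  · exact Nat.lt_succ_iff.mp ((Polynomial.natDegree_lt_iff_degree_lt hf).mpr h)

lemma substPoly_mul (n : ℕ) (A B : Matrix (Fin 2) (Fin 2) K) :
    substPoly n (A * B) = substPoly n B ∘ₗ substPoly n A := by
  ext1 f
  ext1
  simp only [substPoly, LinearMap.coe_mk, AddHom.coe_mk, LinearMap.comp_apply]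
  rw [homogenize_dehomog (isHomogeneous_substForm A (Polynomial.isHomogeneous_homogenize _)),
    substForm_substForm]

lemma substPoly_basis (n : ℕ) (A : Matrix (Fin 2) (Fin 2) K) (i : Fin (n + 1)) :
    (substPoly n A (Polynomial.degreeLT.basis K (n + 1) i) : K[X]) =
      (Polynomial.C (A 0 0) * Polynomial.X + Polynomial.C (A 0 1)) ^ (i : ℕ) *
        (Polynomial.C (A 1 0) * Polynomial.X + Polynomial.C (A 1 1)) ^ (n - i : ℕ) := by
  simp only [substPoly, LinearMap.coe_mk, AddHom.coe_mk, Polynomial.degreeLT.basis_val]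
  rw [Polynomial.homogenize_X_pow (Nat.lt_succ_iff.mp i.2)]
  simp [dehomog, substForm]

lemma prod_pow_mul_pow (n : ℕ) (a b : K) :
    ∏ i : Fin (n + 1), (a ^ (i : ℕ) * b ^ (n - i : ℕ)) =
      (a * b) ^ (∑ i ∈ Finset.range (n + 1), i) := by
  rw [Finset.prod_mul_distrib, mul_pow]
  congr 1
  · rw [Finset.prod_pow_eq_pow_sum, Fin.sum_univ_eq_sum_range (fun i => i)]
  · rw [Finset.prod_pow_eq_pow_sum, Fin.sum_univ_eq_sum_range (fun i => n - i),
      ← Finset.sum_range_reflect]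
    congr 1
    exact Finset.sum_congr rfl fun j hj => by have := Finset.mem_range.mp hj; omega

/-- In the monomial basis the map sends X^i to (αX + β)^i δ^{n-i}, of degree at most i, so its
matrix is upper triangular with diagonal α^i δ^{n-i}. -/
lemma det_substPoly_of_upper (n : ℕ) (A : Matrix (Fin 2) (Fin 2) K) (hA : A 1 0 = 0) :
    (substPoly n A).det = A.det ^ (∑ i ∈ Finset.range (n + 1), i) := by
  rw [← LinearMap.det_toMatrix (Polynomial.degreeLT.basis K (n + 1)),
    Matrix.det_of_isUpperTriangular, Matrix.det_fin_two, hA, mul_zero, sub_zero,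
    ← prod_pow_mul_pow]
  · refine Finset.prod_congr rfl fun i _ => ?_
    rw [LinearMap.toMatrix_apply, Polynomial.degreeLT.basis_repr, substPoly_basis, hA,
      Polynomial.C_0, zero_mul, zero_add, ← Polynomial.C_pow, Polynomial.coeff_mul_C]
    congr 1
    have := Polynomial.coeff_pow_of_natDegree_le (m := i)
      (Polynomial.natDegree_linear_le (a := A 0 0) (b := A 0 1))
    simpa using this
  · intro i j hji
    rw [LinearMap.toMatrix_apply, Polynomial.degreeLT.basis_repr, substPoly_basis, hA,
      Polynomial.C_0, zero_mul, zero_add, ← Polynomial.C_pow, Polynomial.coeff_mul_C,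
      Polynomial.coeff_eq_zero_of_natDegree_lt, zero_mul]
    refine (Polynomial.natDegree_pow_le_of_le (j : ℕ) Polynomial.natDegree_linear_le).trans_lt ?_
    simpa using hji

/-- Here X^i goes to α^i X^i (γX + δ)^{n-i}, a multiple of X^i, so the matrix is lower triangular.
-/
lemma det_substPoly_of_lower (n : ℕ) (A : Matrix (Fin 2) (Fin 2) K) (hA : A 0 1 = 0) :
    (substPoly n A).det = A.det ^ (∑ i ∈ Finset.range (n + 1), i) := by
  have key (i j : Fin (n + 1)) : (LinearMap.toMatrix (Polynomial.degreeLT.basis K (n + 1))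
      (Polynomial.degreeLT.basis K (n + 1)) (substPoly n A)) i j =
      if (j : ℕ) ≤ i then A 0 0 ^ (j : ℕ) * ((Polynomial.C (A 1 0) * Polynomial.X +
        Polynomial.C (A 1 1)) ^ (n - j : ℕ)).coeff (i - j) else 0 := by
    rw [LinearMap.toMatrix_apply, Polynomial.degreeLT.basis_repr, substPoly_basis, hA,
      Polynomial.C_0, add_zero, mul_pow, ← Polynomial.C_pow, mul_assoc, Polynomial.coeff_C_mul,
      Polynomial.coeff_X_pow_mul', mul_ite, mul_zero]
  rw [← LinearMap.det_toMatrix (Polynomial.degreeLT.basis K (n + 1)),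
    Matrix.det_of_isLowerTriangular, Matrix.det_fin_two, hA, zero_mul, sub_zero,
    ← prod_pow_mul_pow]
  · refine Finset.prod_congr rfl fun i _ => ?_
    rw [key, if_pos le_rfl, Nat.sub_self, Polynomial.coeff_zero_eq_eval_zero]
    simp
  · intro i j hij
    rw [key, if_neg]
    simpa using hij

/-- Both sides are multiplicative in A, and an invertible matrix is a product of diagonal matrices
and transvections, all of which are triangular. -/
lemma det_substPoly (n : ℕ) (A : Matrix (Fin 2) (Fin 2) K) (hA : A.det ≠ 0) :
    (substPoly n A).det = A.det ^ (∑ i ∈ Finset.range (n + 1), i) := by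
  refine Matrix.diagonal_transvection_induction_of_det_ne_zero
    (fun A => (substPoly n A).det = A.det ^ (∑ i ∈ Finset.range (n + 1), i)) A hA
    (fun D _ => det_substPoly_of_upper n _ (by simp)) ?_ ?_
  · rintro ⟨i, j, hij, c⟩
    fin_cases i <;> fin_cases j
    · exact absurd rfl hij
    · exact det_substPoly_of_upper n _
        (by simp [Matrix.transvection, Matrix.TransvectionStruct.toMatrix])
    · exact det_substPoly_of_lower n _
        (by simp [Matrix.transvection, Matrix.TransvectionStruct.toMatrix])
    · exact absurd rfl hij
  · intro A B _ _ ihA ihB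
    rw [substPoly_mul, LinearMap.det_comp, ihA, ihB, Matrix.det_mul, mul_pow, mul_comm]

/-- Substitution is multiplicative, so it intertwines the Sylvester maps (p, q) ↦ fq + gp of the old
and new pairs. Taking determinants leaves the exponent d(2d-1) - d(d-1) = d². -/
lemma res_substForm (d : ℕ) (A : Matrix (Fin 2) (Fin 2) K) (hA : A.det ≠ 0)
    {F G : MvPolynomial (Fin 2) K} (hF : F.IsHomogeneous d) (hG : G.IsHomogeneous d) :
    res d (substForm A F, substForm A G) = A.det ^ (d ^ 2) * res d (F, G) := by
  obtain _ | k := d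
  · simp [res]
  have hf := natDegree_dehomog_le hF
  have hg := natDegree_dehomog_le hG
  have hf' := natDegree_dehomog_le (isHomogeneous_substForm A hF)
  have hg' := natDegree_dehomog_le (isHomogeneous_substForm A hG)
  -- With d = k + 1, products such as fq have degree at most 2d - 1 = k + 1 + k; the ascription
  -- matches the codomain of the Sylvester map definitionally.
  let W : Polynomial.degreeLT K (k + 1 + (k + 1)) →ₗ[K] Polynomial.degreeLT K (k + 1 + (k + 1)) :=
    substPoly (k + 1 + k) A
  have hcomm : Polynomial.sylvesterMap _ _ hf' hg' ∘ₗ (substPoly k A).prodMap (substPoly k A) =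
      W ∘ₗ Polynomial.sylvesterMap _ _ hf hg := by
    refine LinearMap.ext fun pq => ?_
    obtain ⟨p, q⟩ := pq
    ext1
    have h1 : (dehomog F * (q : K[X])).homogenize (k + 1 + k) = F * (q : K[X]).homogenize k := by
      rw [Polynomial.homogenize_mul _ _ hf (natDegree_le_of_mem_degreeLT q),
        homogenize_dehomog hF]
    have h2 : (dehomog G * (p : K[X])).homogenize (k + 1 + k) = G * (p : K[X]).homogenize k := by
      rw [Polynomial.homogenize_mul _ _ hg (natDegree_le_of_mem_degreeLT p),
        homogenize_dehomog hG]
    simp only [W, substPoly, LinearMap.comp_apply, LinearMap.prodMap_apply,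
      Polynomial.sylvesterMap_apply_coe, LinearMap.coe_mk, AddHom.coe_mk,
      Polynomial.homogenize_add, h1, h2, substForm_add, substForm_mul]
    simp [dehomog]
  have hdet := congrArg (fun L => (LinearMap.toMatrix
    (((Polynomial.degreeLT.basis K (k + 1)).prod
      (Polynomial.degreeLT.basis K (k + 1))).reindex finSumFinEquiv)
    (Polynomial.degreeLT.basis K (k + 1 + (k + 1))) L).det) hcomm
  rw [LinearMap.toMatrix_comp _ (((Polynomial.degreeLT.basis K (k + 1)).prod
      (Polynomial.degreeLT.basis K (k + 1))).reindex finSumFinEquiv) _,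
    LinearMap.toMatrix_comp _ (Polynomial.degreeLT.basis K (k + 1 + (k + 1))) _,
    Matrix.det_mul, Matrix.det_mul, Polynomial.toMatrix_sylvesterMap',
    Polynomial.toMatrix_sylvesterMap', LinearMap.det_toMatrix] at hdet
  have hW : W.det = A.det ^ (∑ i ∈ Finset.range (k + 1 + k + 1), i) := det_substPoly _ A hA
  rw [LinearMap.det_toMatrix, LinearMap.det_prodMap, det_substPoly k A hA, hW] at hdet
  have he : ∑ i ∈ Finset.range (k + 1 + k + 1), i =
      (k + 1) ^ 2 + (∑ i ∈ Finset.range (k + 1), i + ∑ i ∈ Finset.range (k + 1), i) := by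
    have h1 := Finset.sum_range_id_mul_two (k + 1 + k + 1)
    have h2 := Finset.sum_range_id_mul_two (k + 1)
    simp only [Nat.add_sub_cancel] at h1 h2
    nlinarith
  rw [he, pow_add, pow_add] at hdet
  have hne : A.det ^ (∑ i ∈ Finset.range (k + 1), i) ≠ 0 := pow_ne_zero _ hA
  refine mul_right_cancel₀ (mul_ne_zero hne hne) ?_
  change res (k + 1) (substForm A F, substForm A G) * _ = _ * res (k + 1) (F, G) at hdet
  rw [hdet]
  ring

/-- Row operations: if the last coefficient is nonzero, a multiple of the second polynomial is
removed from the first, then a multiple of the first from the second. -/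
lemma res_linearCombination (d : ℕ) (a b c e : K)
    {F G : MvPolynomial (Fin 2) K} (hF : F.IsHomogeneous d) (hG : G.IsHomogeneous d)
    (h : a * e - b * c ≠ 0) :
    res d (MvPolynomial.C e * F - MvPolynomial.C b * G,
      -MvPolynomial.C c * F + MvPolynomial.C a * G) = (a * e - b * c) ^ d * res d (F, G) := by
  have hf := natDegree_dehomog_le hF
  have hg := natDegree_dehomog_le hG
  have h1 : dehomog (MvPolynomial.C e * F - MvPolynomial.C b * G) =
      Polynomial.C e * dehomog F - Polynomial.C b * dehomog G := by
    simp [dehomog]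
  have h2 : dehomog (-MvPolynomial.C c * F + MvPolynomial.C a * G) =
      -Polynomial.C c * dehomog F + Polynomial.C a * dehomog G := by
    simp [dehomog]
  rw [res, res]
  dsimp only
  rw [h1, h2]
  clear h1 h2
  generalize dehomog F = f at *
  generalize dehomog G = g at *
  have hlin (x y : K) : (Polynomial.C x * f + Polynomial.C y * g).natDegree ≤ d :=
    Polynomial.natDegree_add_le_of_degree_le ((Polynomial.natDegree_C_mul_le _ _).trans hf)
      ((Polynomial.natDegree_C_mul_le _ _).trans hg)
  have key (x y z w : K) (hw : w ≠ 0) : Polynomial.resultant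
      (Polynomial.C x * f + Polynomial.C y * g) (Polynomial.C z * f + Polynomial.C w * g) d d =
      (x * w - y * z) ^ d * Polynomial.resultant f g d d := by
    have e1 : Polynomial.C x * f + Polynomial.C y * g = Polynomial.C ((x * w - y * z) / w) * f +
        (Polynomial.C z * f + Polynomial.C w * g) * Polynomial.C (y / w) := by
      have : x = (x * w - y * z) / w + z * (y / w) := by field_simp; ring
      have h' : y = w * (y / w) := by field_simp
      have hx : Polynomial.C x =
          Polynomial.C ((x * w - y * z) / w) + Polynomial.C z * Polynomial.C (y / w) := by
        rw [← Polynomial.C_mul, ← Polynomial.C_add, ← this]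
      have hy : Polynomial.C y = Polynomial.C w * Polynomial.C (y / w) := by
        rw [← Polynomial.C_mul, ← h']
      rw [hx, hy]
      ring
    rw [e1, Polynomial.resultant_add_mul_left _ _ _ _ _ (by simp) (hlin z w),
      Polynomial.resultant_C_mul_left,
      show Polynomial.C z * f + Polynomial.C w * g = Polynomial.C w * g + f * Polynomial.C z by ring,
      Polynomial.resultant_add_mul_right _ _ _ _ _ (by simp) hf,
      Polynomial.resultant_C_mul_right, ← mul_assoc, ← mul_pow]
    congr 2
    field_simp
  -- `key` needs a nonzero last coefficient. If a = 0 then b ≠ 0, and the two entries are exchanged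
  -- at the cost of the sign (-1)^{d·d}.
  by_cases ha : a = 0
  · subst ha
    have hb : b ≠ 0 := by rintro rfl; simp at h
    have := key (-c) 0 e (-b) (neg_ne_zero.mpr hb)
    rw [Polynomial.C_neg, Polynomial.C_neg, neg_mul, neg_mul, ← sub_eq_add_neg, ← neg_mul] at this
    rw [Polynomial.resultant_comm, this, ← mul_assoc, pow_mul, ← mul_pow]
    rcases Nat.even_or_odd d with hd | hd
    · rw [hd.neg_one_pow, one_mul]
      congr 1
      rw [← hd.neg_pow]
      congr 1
      ring
    · rw [hd.neg_one_pow]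
      congr 2
      ring
  · have := key e (-b) (-c) a ha
    rw [Polynomial.C_neg, Polynomial.C_neg] at this
    rw [sub_eq_add_neg, ← neg_mul, this]
    congr 2
    ring
end Resultant
-- The right action, its effect on resultants, and its scalars.
section Action

variable {K : Type*} [Field K]

lemma det_ne_zero (g : Trans K) : (g.2 : Matrix (Fin 2) (Fin 2) K).det ≠ 0 :=
  ((Matrix.isUnit_iff_isUnit_det _).mp g.2.isUnit).ne_zero

lemma act_fst (P : FormPair K) (g : Trans K) : (act P g).1 = MvPolynomial.C (g.1 : K) *
    (MvPolynomial.C (g.2 1 1) * substForm g.2 P.1 - MvPolynomial.C (g.2 0 1) * substForm g.2 P.2) :=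
  rfl

lemma act_snd (P : FormPair K) (g : Trans K) : (act P g).2 = MvPolynomial.C (g.1 : K) *
    (-MvPolynomial.C (g.2 1 0) * substForm g.2 P.1 +
      MvPolynomial.C (g.2 0 0) * substForm g.2 P.2) :=
  rfl

lemma act_act (P : FormPair K) (g h : Trans K) : act (act P g) h = act P (g * h) := by
  have hdef (i j : Fin 2) : (g * h).2 i j = g.2 i 0 * h.2 0 j + g.2 i 1 * h.2 1 j := by
    simp [Matrix.mul_apply, Fin.sum_univ_two]
  have hs (F : MvPolynomial (Fin 2) K) : substForm (h.2 : Matrix (Fin 2) (Fin 2) K)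
      (substForm (g.2 : Matrix (Fin 2) (Fin 2) K) F) =
      substForm ((g * h).2 : Matrix (Fin 2) (Fin 2) K) F := by
    rw [substForm_substForm]
    rfl
  refine Prod.ext ?_ ?_
  · simp only [act_fst, act_snd, substForm_mul, substForm_sub, substForm_add, substForm_neg,
      substForm_C, hs, hdef, Prod.fst_mul, Units.val_mul, map_add, map_mul]
    ring
  · simp only [act_fst, act_snd, substForm_mul, substForm_sub, substForm_add, substForm_neg,
      substForm_C, hs, hdef, Prod.fst_mul, Units.val_mul, map_add, map_mul]
    ring

lemma isHomogeneous_act {d : ℕ} {P : FormPair K} (h1 : P.1.IsHomogeneous d)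
    (h2 : P.2.IsHomogeneous d) (g : Trans K) :
    (act P g).1.IsHomogeneous d ∧ (act P g).2.IsHomogeneous d := by
  have hs1 := isHomogeneous_substForm g.2 h1
  have hs2 := isHomogeneous_substForm g.2 h2
  rw [act_fst, act_snd]
  exact ⟨((hs1.C_mul _).sub (hs2.C_mul _)).C_mul _,
    (MvPolynomial.IsHomogeneous.add (by rw [← map_neg]; exact hs1.C_mul _) (hs2.C_mul _)).C_mul _⟩

lemma res_act {d : ℕ} {P : FormPair K} (h1 : P.1.IsHomogeneous d)
    (h2 : P.2.IsHomogeneous d) (g : Trans K) :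
    res d (act P g) = (g.1 : K) ^ (2 * d) *
      (g.2 : Matrix (Fin 2) (Fin 2) K).det ^ (d ^ 2 + d) * res d P := by
  have hs1 := isHomogeneous_substForm g.2 h1
  have hs2 := isHomogeneous_substForm g.2 h2
  have hdet : (g.2 : Matrix (Fin 2) (Fin 2) K).det ≠ 0 := det_ne_zero g
  have hdet' := Matrix.det_fin_two (g.2 : Matrix (Fin 2) (Fin 2) K)
  have e1 := res_linearCombination d _ _ _ _ hs1 hs2 (hdet' ▸ hdet)
  rw [res_substForm d _ hdet h1 h2, ← hdet'] at e1
  have e2 (F G : MvPolynomial (Fin 2) K) (c : K) : res d (MvPolynomial.C c * F,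
      MvPolynomial.C c * G) = c ^ (2 * d) * res d (F, G) := by
    have hm (F : MvPolynomial (Fin 2) K) :
        dehomog (MvPolynomial.C c * F) = Polynomial.C c * dehomog F := by
      simp [dehomog]
    rw [res, res]
    dsimp only
    rw [hm, hm, Polynomial.resultant_C_mul_left, Polynomial.resultant_C_mul_right]
    ring
  refine (e2 _ _ _).trans ?_
  rw [e1]
  ring

lemma isModel_act {d : ℕ} {P : FormPair K} (hP : IsModel d P) (g : Trans K) :
    IsModel d (act P g) := by
  obtain ⟨h1, h2, h3⟩ := hP
  have h := isHomogeneous_act h1 h2 g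
  refine ⟨h.1, h.2, ?_⟩
  rw [res_act h1 h2]
  exact mul_ne_zero (mul_ne_zero (pow_ne_zero _ g.1.ne_zero)
    (pow_ne_zero _ (det_ne_zero g))) h3

lemma substForm_scalar {d : ℕ} {F : MvPolynomial (Fin 2) K} (hF : F.IsHomogeneous d) (c : K) :
    substForm (Matrix.scalar (Fin 2) c) F = MvPolynomial.C (c ^ d) * F := by
  rw [substForm, F.as_sum, map_sum, Finset.mul_sum]
  refine Finset.sum_congr rfl fun m hm => ?_
  have h := hF (MvPolynomial.mem_support_iff.mp hm)
  rw [Finsupp.weight_apply, Finsupp.sum_fintype _ _ (by simp)] at h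
  rw [MvPolynomial.aeval_monomial, MvPolynomial.monomial_eq, Finsupp.prod_fintype _ _ (by simp),
    Finsupp.prod_fintype _ _ (by simp)]
  simp [Fin.sum_univ_two] at h
  simp [Fin.prod_univ_two, mul_pow, ← h, pow_add]
  ring

lemma act_scalarHom {d : ℕ} {P : FormPair K} (h1 : P.1.IsHomogeneous d)
    (h2 : P.2.IsHomogeneous d) (c : Kˣ) : act P (scalarHom d K c) = P := by
  have hA : ((scalarHom d K c).2 : Matrix (Fin 2) (Fin 2) K) = Matrix.scalar (Fin 2) (c : K) := rfl
  have hl : ((scalarHom d K c).1 : K) * ((c : K) * (c : K) ^ d) = 1 := by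
    rw [← pow_succ']
    simp only [scalarHom, MonoidHom.prod_apply, zpowGroupHom_apply]
    rw [zpow_neg, ← Nat.cast_succ, zpow_natCast]
    simp
  have hs1 := substForm_scalar h1 (c : K)
  have hs2 := substForm_scalar h2 (c : K)
  have h00 (F : MvPolynomial (Fin 2) K) : MvPolynomial.C ((scalarHom d K c).1 : K) *
      (MvPolynomial.C (c : K) * (MvPolynomial.C ((c : K) ^ d) * F)) = F := by
    rw [← mul_assoc (MvPolynomial.C (c : K)), ← mul_assoc, ← map_mul, ← map_mul, hl, map_one,
      one_mul]
  refine Prod.ext ?_ ?_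
  · rw [act_fst, hA, hs1, hs2]
    simpa using h00 P.1
  · rw [act_snd, hA, hs1, hs2]
    simpa using h00 P.2

end Action

/-! ### Integral transformations preserve integral models. -/

section Integral

variable (R : Type*) [CommRing R] {K : Type*} [Field K] [Algebra R K]

lemma isOver_act {P : FormPair K} (hP : IsOver R P) {g : Trans K}
    (hg : g ∈ integralSubgroup R K) : IsOver R (act P g) := by
  obtain ⟨⟨l, A⟩, rfl⟩ := hg
  have hC (r : R) : MvPolynomial.C (algebraMap R K r) ∈
      (MvPolynomial.map (σ := Fin 2) (algebraMap R K)).range := ⟨MvPolynomial.C r, by simp⟩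
  have hX (i : Fin 2) : (MvPolynomial.X i : MvPolynomial (Fin 2) K) ∈
      (MvPolynomial.map (σ := Fin 2) (algebraMap R K)).range := ⟨MvPolynomial.X i, by simp⟩
  have hs {F : MvPolynomial (Fin 2) K}
      (hF : F ∈ (MvPolynomial.map (σ := Fin 2) (algebraMap R K)).range) :
      substForm ((A : Matrix (Fin 2) (Fin 2) R).map (algebraMap R K)) F ∈
        (MvPolynomial.map (σ := Fin 2) (algebraMap R K)).range := by
    obtain ⟨F, rfl⟩ := hF
    induction F using MvPolynomial.induction_on with
    | C c => simpa [substForm_C] using hC c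
    | add p q hp hq => simpa [substForm_add] using add_mem hp hq
    | mul_X p i hp =>
      rw [map_mul, substForm_mul, MvPolynomial.map_X, substForm_X]
      exact mul_mem hp (add_mem (mul_mem (hC _) (hX _)) (mul_mem (hC _) (hX _)))
  have h1 := hs hP.1
  have h2 := hs hP.2
  exact ⟨mul_mem (hC _) (sub_mem (mul_mem (hC _) h1) (mul_mem (hC _) h2)),
    mul_mem (hC _) (add_mem (mul_mem (neg_mem (hC _)) h1) (mul_mem (hC _) h2))⟩

end Integral

/-! ### Finiteness of the residue rings of R. -/

section FiniteQuotients

/-- If `C` is a domain that is torsion-free of finite rank over a principal ideal domain `A`, then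
`C / aC` is finite whenever `A / aA` is. -/
lemma finite_quotient_span_algebraMap {A C : Type*} [CommRing A] [IsDomain A]
    [IsPrincipalIdealRing A] [CommRing C] [Algebra A C] [Module.IsTorsionFree A C]
    (n : ℕ) (hn : Module.rank A C ≤ n) (a : A) [Finite (A ⧸ Ideal.span {a})] :
    Finite (C ⧸ Ideal.span {algebraMap A C a}) := by
  classical
  -- C need not be known to be finitely generated over A, so cardinalities of finite sets of classes
  -- are bounded uniformly. Lifts of such a set span a free module N of rank at most n, and classes
  -- distinct modulo aC stay distinct modulo aN.
  suffices h : ∀ t : Finset (C ⧸ Ideal.span {algebraMap A C a}),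
      t.card ≤ Nat.card (A ⧸ Ideal.span {a}) ^ n by
    by_contra hinf
    rw [not_finite_iff_infinite] at hinf
    obtain ⟨t, ht⟩ := Infinite.exists_subset_card_eq (C ⧸ Ideal.span {algebraMap A C a})
      (Nat.card (A ⧸ Ideal.span {a}) ^ n + 1)
    have := h t
    omega
  intro t
  let σ : C ⧸ Ideal.span {algebraMap A C a} → C := Function.surjInv Ideal.Quotient.mk_surjective
  have hσ (x) : Ideal.Quotient.mk (Ideal.span {algebraMap A C a}) (σ x) = x :=
    Function.surjInv_eq _ x
  let N : Submodule A C := Submodule.span A (t.image σ : Set C)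
  have : Module.Finite A N := Module.Finite.span_finset A _
  have : Module.Free A N := Module.free_of_finite_type_torsion_free'
  have hr : Module.finrank A N ≤ n := by
    have h := (Submodule.rank_le N).trans hn
    rw [← Module.finrank_eq_rank] at h
    exact_mod_cast h
  let b := Module.finBasis A N
  have hmem (x : t) : σ x ∈ N :=
    Submodule.subset_span (Finset.mem_coe.mpr (Finset.mem_image_of_mem σ x.2))
  let f : t → (Fin (Module.finrank A N) → A ⧸ Ideal.span {a}) := fun x i =>
    Ideal.Quotient.mk _ (b.repr ⟨σ x, hmem x⟩ i)
  have hf : Function.Injective f := by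
    intro x y hxy
    let u : N := ⟨σ x, hmem x⟩
    let v : N := ⟨σ y, hmem y⟩
    have hdvd (i) : ∃ c, b.repr (u - v) i = a * c := by
      have h := congrFun hxy i
      rw [Ideal.Quotient.eq, Ideal.mem_span_singleton] at h
      obtain ⟨c, hc⟩ := h
      exact ⟨c, by simpa [u, v] using hc⟩
    choose c hc using hdvd
    have hz : u - v = a • ∑ i, c i • b i := by
      rw [← b.sum_repr (u - v), Finset.smul_sum]
      exact Finset.sum_congr rfl fun i _ => by rw [hc, mul_smul]
    have hz' : σ x - σ y = algebraMap A C a * ((∑ i, c i • b i : N) : C) := by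
      rw [← Algebra.smul_def]
      exact congrArg Subtype.val hz
    apply Subtype.ext
    rw [← hσ x, ← hσ y, Ideal.Quotient.eq, Ideal.mem_span_singleton]
    exact ⟨_, hz'⟩
  have := Nat.card_le_card_of_injective f hf
  rw [Nat.card_fun, Nat.card_eq_fintype_card, Fintype.card_coe] at this
  refine this.trans ?_
  rw [Nat.card_fin]
  exact Nat.pow_le_pow_right Nat.card_pos hr

/-- By integrality a nonzero ideal I contains a nonzero a from A, so C/I is a quotient of C/aC. -/
lemma hasFiniteQuotients_of_isIntegral {A C : Type*} [CommRing A] [IsDomain A]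
    [IsPrincipalIdealRing A] [CommRing C] [IsDomain C] [Algebra A C] [Module.IsTorsionFree A C]
    [Algebra.IsIntegral A C] [Ring.HasFiniteQuotients A]
    (n : ℕ) (hn : Module.rank A C ≤ n) : Ring.HasFiniteQuotients C where
  finiteQuotient {I} hI := by
    obtain ⟨a, ha, ha0⟩ : ∃ a : A, algebraMap A C a ∈ I ∧ a ≠ 0 := by
      obtain ⟨x, hx, hx0⟩ := Submodule.exists_mem_ne_zero_of_ne_bot hI
      have := Ideal.comap_ne_bot_of_integral_mem (R := A) hx0 hx (Algebra.IsIntegral.isIntegral x)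
      obtain ⟨a, ha, ha0⟩ := Submodule.exists_mem_ne_zero_of_ne_bot this
      exact ⟨a, ha, ha0⟩
    have : Finite (A ⧸ Ideal.span {a}) := Ring.HasFiniteQuotients.finiteQuotient (by simpa)
    have := finite_quotient_span_algebraMap n hn a
    exact Finite.of_surjective (Ideal.Quotient.factor
      ((Ideal.span_singleton_le_iff_mem (I := I)).mpr ha)) (Ideal.Quotient.factor_surjective _)

lemma rank_le_finrank_of_injective {A F L C : Type*} [CommRing A] [IsDomain A] [Field F]
    [Algebra A F] [IsFractionRing A F] [Field L] [Algebra A L] [Algebra F L] [IsScalarTower A F L]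
    [FiniteDimensional F L] [CommRing C] [Algebra A C] [Algebra C L] [IsScalarTower A C L]
    (hinj : Function.Injective (algebraMap C L)) :
    Module.rank A C ≤ Module.finrank F L := by
  have h := LinearMap.lift_rank_le_of_injective (IsScalarTower.toAlgHom A C L).toLinearMap hinj
  rw [← IsLocalization.rank_eq (N := L) F (nonZeroDivisors A) le_rfl, ← Module.finrank_eq_rank F L,
    Cardinal.lift_natCast, Cardinal.lift_le_nat_iff] at h
  exact h

lemma hasFiniteQuotients_polynomial (k : Type*) [Field k] [Finite k] :
    Ring.HasFiniteQuotients k[X] where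
  finiteQuotient {I} hI := by
    obtain ⟨f, hf, hf0⟩ := Submodule.exists_mem_ne_zero_of_ne_bot hI
    have : Module.Finite k (AdjoinRoot f) := (AdjoinRoot.powerBasis hf0).finite
    have : Finite (AdjoinRoot f) := Module.finite_of_finite k
    have : Finite (k[X] ⧸ Ideal.span {f}) := this
    exact Finite.of_surjective (Ideal.Quotient.factor
      ((Ideal.span_singleton_le_iff_mem (I := I)).mpr hf)) (Ideal.Quotient.factor_surjective _)

lemma properties_of_isIntegralClosure (A F R K : Type*) [CommRing A] [IsDomain A]
    [IsPrincipalIdealRing A] [Ring.HasFiniteQuotients A] [Field F] [Algebra A F]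
    [IsFractionRing A F] [Field K] [Algebra A K] [Algebra F K] [IsScalarTower A F K]
    [FiniteDimensional F K] [CommRing R] [Algebra R K] [IsIntegralClosure R A K] :
    IsDomain R ∧ IsFractionRing R K ∧ Ring.HasFiniteQuotients R := by
  have hinj := IsIntegralClosure.algebraMap_injective R A K
  have hR : IsDomain R := hinj.isDomain (algebraMap R K)
  have hA : Function.Injective (algebraMap A K) := by
    rw [IsScalarTower.algebraMap_eq A F K]
    exact (algebraMap F K).injective.comp (IsFractionRing.injective A F)
  -- `IsIntegralClosure` does not include an A-algebra structure on R; it is built by lifting the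
  -- image of A in K.
  let φ : A →+* R :=
    { toFun := fun x => IsIntegralClosure.mk' R (algebraMap A K x) isIntegral_algebraMap
      map_one' := hinj (by simp)
      map_zero' := hinj (by simp)
      map_add' := fun x y => hinj (by simp)
      map_mul' := fun x y => hinj (by simp) }
  let _ : Algebra A R := φ.toAlgebra
  have : IsScalarTower A R K := IsScalarTower.of_algebraMap_eq fun x =>
    (IsIntegralClosure.algebraMap_mk' R (algebraMap A K x) isIntegral_algebraMap).symm
  have : Module.IsTorsionFree A K := Module.isTorsionFree_iff_algebraMap_injective.mpr hA
  have : Module.IsTorsionFree A R := IsIntegralClosure.isTorsionFree (A := R) A K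
  have : Algebra.IsIntegral A R := IsIntegralClosure.isIntegral_algebra (A := R) A K
  exact ⟨hR, IsIntegralClosure.isFractionRing_of_finite_extension A F K R,
    hasFiniteQuotients_of_isIntegral (A := A) _
      (rank_le_finrank_of_injective (A := A) (F := F) (L := K) hinj)⟩

lemma IsRingOfIntegersOfGlobalField.properties {R K : Type*} [CommRing R] [Field K] [Algebra R K]
    (h : IsRingOfIntegersOfGlobalField R K) :
    IsDomain R ∧ IsFractionRing R K ∧ Ring.HasFiniteQuotients R := by
  cases h with
  | numberField => exact properties_of_isIntegralClosure ℤ ℚ R K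
  | functionField Fq =>
    have := hasFiniteQuotients_polynomial Fq
    exact properties_of_isIntegralClosure Fq[X] Fq⟮X⟯ R K

end FiniteQuotients
-- Finite unions of cosets.
/-- A subset of a group that is stable under right multiplication by `H` is a finite union of left
cosets of `H` if its elements can be labelled by a finite type so that equal labels imply equal
cosets. -/
lemma exists_finset_eq_iUnion_smul {G ι : Type*} [Group G] [Finite ι] (S : Set G)
    (H : Subgroup G) (hS : ∀ g ∈ S, ∀ h ∈ H, g * h ∈ S) (r : G → ι → Prop)
    (hr : ∀ g ∈ S, ∃ i, r g i) (hrr : ∀ g ∈ S, ∀ h ∈ S, ∀ i, r g i → r h i → g⁻¹ * h ∈ H) :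
    ∃ s : Finset G, S = ⋃ g ∈ s, g • (H : Set G) := by
  classical
  have := Fintype.ofFinite ι
  let T : Finset ι := Finset.univ.filter fun i => ∃ g ∈ S, r g i
  have hT (i : T) : ∃ g ∈ S, r g i := (Finset.mem_filter.mp i.2).2
  choose f hfS hfr using hT
  refine ⟨Finset.univ.image f, ?_⟩
  ext g
  simp only [Finset.mem_image, Finset.mem_univ, true_and, Set.iUnion_exists, Set.iUnion_iUnion_eq',
    Set.mem_iUnion, Set.mem_smul_set_iff_inv_smul_mem, smul_eq_mul, SetLike.mem_coe]
  constructor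
  · intro hg
    obtain ⟨i, hi⟩ := hr g hg
    exact ⟨⟨i, Finset.mem_filter.mpr ⟨Finset.mem_univ _, g, hg, hi⟩⟩,
      hrr _ (hfS _) _ hg i (hfr _) hi⟩
  · rintro ⟨i, hi⟩
    simpa using hS _ (hfS i) _ hi

lemma mul_mem_of_mem_sup {G : Type*} [Group G] {S : Set G} {H H' : Subgroup G}
    (hH : ∀ g ∈ S, ∀ h ∈ H, g * h ∈ S) (hH' : ∀ g ∈ S, ∀ h ∈ H', g * h ∈ S) :
    ∀ g ∈ S, ∀ h ∈ H ⊔ H', g * h ∈ S := by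
  intro g hg h hh
  rw [Subgroup.sup_eq_closure] at hh
  -- Including inverses in the claim lets the closure induction pass through its inverse case.
  suffices hs : ∀ g ∈ S, g * h ∈ S ∧ g * h⁻¹ ∈ S from (hs g hg).1
  clear hg g
  induction hh using Subgroup.closure_induction with
  | mem x hx =>
    rcases hx with hx | hx
    · exact fun g hg => ⟨hH g hg x hx, hH g hg _ (inv_mem hx)⟩
    · exact fun g hg => ⟨hH' g hg x hx, hH' g hg _ (inv_mem hx)⟩
  | one => simp
  | mul x y _ _ hx hy =>
    intro g hg
    rw [← mul_assoc, mul_inv_rev, ← mul_assoc]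
    exact ⟨(hy _ (hx g hg).1).1, (hx _ (hy g hg).2).2⟩
  | inv x _ hx =>
    intro g hg
    rw [inv_inv]
    exact (hx g hg).symm

/-! ### Minimal transformations in terms of units, and their stability. -/

section

variable {R K : Type*} [CommRing R] [Field K] [Algebra R K]

/-- The resultants of P and of P^g generate the same ideal exactly when their quotient, given by
`res_act`, is a unit. -/
lemma mem_minTran_iff [IsDomain R] [FaithfulSMul R K] {d : ℕ} {P : FormPair K}
    (hP : IsMinimalModel R d P) (g : Trans K) :
    g ∈ minTran R d P ↔ IsOver R (act P g) ∧ ∃ u : Rˣ, algebraMap R K u =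
      (g.1 : K) ^ (2 * d) * (g.2 : Matrix (Fin 2) (Fin 2) K).det ^ (d ^ 2 + d) := by
  obtain ⟨hM, -, -, ρ, hρ, hI⟩ := hP
  have hinj := FaithfulSMul.algebraMap_injective R K
  have hres := res_act hM.1 hM.2.1 g
  constructor
  · rintro ⟨-, hover, r, hr, hrI⟩
    refine ⟨hover, ?_⟩
    obtain ⟨u, hu⟩ := Ideal.span_singleton_eq_span_singleton.mp (hI.symm.trans hrI)
    refine ⟨u, mul_right_cancel₀ hM.2.2 ?_⟩
    rw [← hres, ← hr, ← hu, map_mul, hρ, mul_comm]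
  · rintro ⟨hover, u, hu⟩
    refine ⟨⟨isModel_act hM g, g, rfl⟩, hover, u * ρ, ?_, ?_⟩
    · rw [hres, map_mul, hu, hρ]
    · rw [hI]
      exact Ideal.span_singleton_eq_span_singleton.mpr ⟨u, mul_comm _ _⟩

lemma mul_mem_minTran_of_mem_integralSubgroup [IsDomain R] [FaithfulSMul R K] {d : ℕ}
    {P : FormPair K} (hP : IsMinimalModel R d P) {g h : Trans K} (hg : g ∈ minTran R d P)
    (hh : h ∈ integralSubgroup R K) : g * h ∈ minTran R d P := by
  rw [mem_minTran_iff hP] at hg ⊢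
  obtain ⟨hover, u, hu⟩ := hg
  refine ⟨by rw [← act_act]; exact isOver_act R hover hh, ?_⟩
  obtain ⟨⟨l, V⟩, rfl⟩ := hh
  refine ⟨u * (l ^ (2 * d) * Matrix.GeneralLinearGroup.det V ^ (d ^ 2 + d)), ?_⟩
  have hV : ((Matrix.GeneralLinearGroup.map (algebraMap R K) V : GL (Fin 2) K) :
      Matrix (Fin 2) (Fin 2) K).det = algebraMap R K (V : Matrix (Fin 2) (Fin 2) R).det :=
    (RingHom.map_det (algebraMap R K) _).symm
  simp only [Units.val_mul, map_mul, hu, Units.val_pow_eq_pow_val, map_pow, Prod.fst_mul,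
    Prod.snd_mul, MonoidHom.coe_prodMap, Prod.map_fst, Prod.map_snd, Units.coe_map,
    Matrix.det_mul, hV, Matrix.GeneralLinearGroup.val_det_apply, MonoidHom.coe_coe]
  ring

lemma mul_mem_minTran_of_mem_scalarSubgroup {d : ℕ} {P : FormPair K} (hP : IsModel d P)
    {g h : Trans K} (hg : g ∈ minTran R d P) (hh : h ∈ scalarSubgroup d K) :
    g * h ∈ minTran R d P := by
  obtain ⟨c, rfl⟩ := hh
  have := isModel_act hP g
  have h := act_scalarHom this.1 this.2.1 c
  rw [act_act] at h
  rwa [minTran, Set.mem_ofPred_eq, h]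

end

/-! ### Primitive representatives, and roots of units. -/

section Primitive

variable {R K : Type*} [CommRing R] [IsDomain R] [IsPrincipalIdealRing R] [Field K] [Algebra R K]
  [IsFractionRing R K]

lemma exists_primitive_multiple (B : GL (Fin 2) K) : ∃ (c : Kˣ) (A : Matrix (Fin 2) (Fin 2) R),
    Ideal.span (Set.range fun ij : Fin 2 × Fin 2 => A ij.1 ij.2) = ⊤ ∧
      (B : Matrix (Fin 2) (Fin 2) K) = (c : K) • A.map (algebraMap R K) := by
  obtain ⟨b, hb⟩ := IsLocalization.exist_integer_multiples_of_finite (nonZeroDivisors R)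
    -- The scalar will be e/b, with b a common denominator and e a gcd of the cleared entries; a
    -- Bézout relation for e, divided by e, gives primitivity.
    (fun ij : Fin 2 × Fin 2 => (B : Matrix (Fin 2) (Fin 2) K) ij.1 ij.2)
  choose N hN using hb
  have hinj := IsFractionRing.injective R K
  have hb0 : algebraMap R K b ≠ 0 := by
    rw [map_ne_zero_iff _ hinj]
    exact nonZeroDivisors.coe_ne_zero b
  obtain ⟨e, he⟩ := (IsPrincipalIdealRing.principal (Ideal.span (Set.range N))).principal
  rw [← Ideal.span] at he
  have hdvd (ij) : ∃ a, N ij = e * a := by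
    have : N ij ∈ Ideal.span {e} := he ▸ Ideal.subset_span ⟨ij, rfl⟩
    exact Ideal.mem_span_singleton.mp this
  choose a ha using hdvd
  have hB (ij : Fin 2 × Fin 2) : (B : Matrix (Fin 2) (Fin 2) K) ij.1 ij.2 =
      algebraMap R K e / algebraMap R K b * algebraMap R K (a ij) := by
    have h := hN ij
    rw [Algebra.smul_def, ha, map_mul] at h
    field_simp
    rw [h]
    ring
  have he0 : e ≠ 0 := by
    rintro rfl
    apply (B.isUnit.map Matrix.detMonoidHom).ne_zero
    rw [Matrix.coe_detMonoidHom, Matrix.det_fin_two, hB (0, 0), hB (0, 1)]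
    simp
  refine ⟨Units.mk0 (algebraMap R K e / algebraMap R K b)
    (div_ne_zero ((map_ne_zero_iff _ hinj).mpr he0) hb0), Matrix.of fun i j => a (i, j), ?_, ?_⟩
  · have h1 : e ∈ Ideal.span (Set.range N) := he ▸ Ideal.mem_span_singleton_self e
    obtain ⟨c, hc⟩ := Submodule.mem_span_range_iff_exists_fun R |>.mp h1
    rw [Ideal.eq_top_iff_one]
    have h2 : (1 : R) = ∑ ij, c ij * a ij := by
      apply mul_left_cancel₀ he0
      rw [mul_one, Finset.mul_sum]
      conv_lhs => rw [← hc]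
      exact Finset.sum_congr rfl fun ij _ => by rw [smul_eq_mul, ha]; ring
    rw [h2]
    exact Ideal.sum_mem _ fun ij _ => Ideal.mul_mem_left _ _ (Ideal.subset_span ⟨ij, rfl⟩)
  · ext i j
    exact hB (i, j)

/-- A root of a unit is integral over R, so lies in R, and an element with a unit power is a unit.
-/
lemma exists_unit_of_pow_eq {x : K} {n : ℕ} (hn : 0 < n) {u : Rˣ} (h : x ^ n = algebraMap R K u) :
    ∃ w : Rˣ, algebraMap R K w = x := by
  obtain ⟨y, rfl⟩ := IsIntegrallyClosed.exists_algebraMap_eq_of_isIntegral_pow (R := R) hn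
    (h ▸ isIntegral_algebraMap)
  rw [← map_pow] at h
  have : IsUnit (y ^ n) := IsFractionRing.injective R K h ▸ u.isUnit
  obtain ⟨w, hw⟩ := (isUnit_pow_iff hn.ne').mp this
  exact ⟨w, by rw [hw]⟩

lemma exists_unit_sq_mul_det_pow {d : ℕ} (hd : 0 < d) {l D : K} {u : Rˣ}
    (h : algebraMap R K u = l ^ (2 * d) * D ^ (d ^ 2 + d)) :
    ∃ w : Rˣ, algebraMap R K w = l ^ 2 * D ^ (d + 1) :=
  exists_unit_of_pow_eq hd (u := u) (by rw [h]; ring)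

end Primitive

/-! ### The bound on the determinant at a column of A. -/

section Divisibility

variable {R K : Type*} [CommRing R] [Field K] [Algebra R K]

lemma eval_map_algebraMap (v : Fin 2 → R) (F : MvPolynomial (Fin 2) R) :
    MvPolynomial.eval (fun i => algebraMap R K (v i)) (MvPolynomial.map (algebraMap R K) F) =
      algebraMap R K (MvPolynomial.eval v F) := by
  induction F using MvPolynomial.induction_on with
  | C c => simp
  | add p q hp hq => simp only [map_add, hp, hq]
  | mul_X p i hp => simp only [map_mul, hp, MvPolynomial.map_X, MvPolynomial.eval_X]

lemma eval_substForm (A : Matrix (Fin 2) (Fin 2) K) (F : MvPolynomial (Fin 2) K) (j : Fin 2) :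
    MvPolynomial.eval (Pi.single j 1) (substForm A F) = MvPolynomial.eval (fun i => A i j) F := by
  induction F using MvPolynomial.induction_on with
  | C c => simp [substForm_C]
  | add p q hp hq => rw [substForm_add, map_add, map_add, hp, hq]
  | mul_X p i hp =>
    rw [substForm_mul, map_mul, map_mul, hp, substForm_X]
    fin_cases j <;> simp

variable [FaithfulSMul R K]

/-- If `F, G` are forms of degree `d` over `R` then `Res_d(F, G) Y^{2d-1}` lies in the ideal
`(F, G)`; here evaluated at a point. -/
lemma exists_eval_mul_add_eval_mul {d : ℕ} (hd : 0 < d) {F G : MvPolynomial (Fin 2) R}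
    (hF : F.IsHomogeneous d) (hG : G.IsHomogeneous d) {ρ : R}
    (hρ : algebraMap R K ρ = res d (MvPolynomial.map (algebraMap R K) F,
      MvPolynomial.map (algebraMap R K) G)) (v : Fin 2 → R) :
    ∃ a b, MvPolynomial.eval v F * a + MvPolynomial.eval v G * b = ρ * v 1 ^ (2 * d - 1) := by
  have hinj := FaithfulSMul.algebraMap_injective R K
  have hmap (F : MvPolynomial (Fin 2) R) : dehomog (MvPolynomial.map (algebraMap R K) F) =
      (MvPolynomial.aeval ![Polynomial.X, 1] F : R[X]).map (algebraMap R K) := by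
    induction F using MvPolynomial.induction_on with
    | C c => simp [dehomog]
    | add p q hp hq =>
      simp only [map_add, Polynomial.map_add, ← hp, ← hq]
      exact map_add _ _ _
    | mul_X p i hp =>
      simp only [map_mul, Polynomial.map_mul, ← hp, MvPolynomial.map_X, MvPolynomial.aeval_X]
      refine (map_mul _ _ _).trans ?_
      congr 1
      fin_cases i <;> simp
  have hdeg {F : MvPolynomial (Fin 2) R} (hF : F.IsHomogeneous d) :
      (MvPolynomial.aeval ![Polynomial.X, 1] F : R[X]).natDegree ≤ d := by
    rw [← Polynomial.natDegree_map_eq_of_injective hinj, ← hmap]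
    exact natDegree_dehomog_le (hF.map _)
  rw [res] at hρ
  dsimp only at hρ
  rw [hmap, hmap, Polynomial.resultant_map_map] at hρ
  obtain ⟨p, q, hp, hq, hpq⟩ := Polynomial.exists_mul_add_mul_eq_C_resultant _ _ (hdeg hF)
    (hdeg hG) (Or.inl hd.ne')
  rw [← hinj hρ] at hpq
  have hle {p : R[X]} (hp : p.degree < d) : p.natDegree ≤ d - 1 := by
    by_cases h0 : p = 0
    · simp [h0]
    · have := (Polynomial.natDegree_lt_iff_degree_lt h0).mpr hp
      omega
  -- Homogenizing the Bézout identity in degree 2d - 1 turns the constant ρ into ρY^{2d-1}.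
  have h := congrArg (fun f => MvPolynomial.eval v (f.homogenize (d + (d - 1)))) hpq
  rw [Polynomial.homogenize_add, Polynomial.homogenize_mul _ _ (hdeg hF) (hle hp),
    Polynomial.homogenize_mul _ _ (hdeg hG) (hle hq),
    Polynomial.homogenize_eq_of_isHomogeneous hF rfl,
    Polynomial.homogenize_eq_of_isHomogeneous hG rfl, Polynomial.homogenize_C,
    show d + (d - 1) = 2 * d - 1 by omega] at h
  simp only [map_add, map_mul, map_pow, MvPolynomial.eval_C, MvPolynomial.eval_X] at h
  exact ⟨_, _, h⟩

/-- With v the j-th column of A, evaluating P^g at the j-th unit vector and multiplying by A shows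
that λ det(A) F(v) and λ det(A) G(v) lie in R. Only λ² is controlled by det A, hence the square of ρ
and the passage to products of two values. -/
lemma det_dvd_of_isOver_act {d : ℕ} (hd : 2 ≤ d) {P : FormPair K} (h1 : P.1.IsHomogeneous d)
    (h2 : P.2.IsHomogeneous d) (hP : IsOver R P) {ρ : R} (hρ : algebraMap R K ρ = res d P)
    {g : Trans K} {A : Matrix (Fin 2) (Fin 2) R}
    (hA : (g.2 : Matrix (Fin 2) (Fin 2) K) = A.map (algebraMap R K)) (hg : IsOver R (act P g))
    {w : Rˣ} (hw : algebraMap R K w = (g.1 : K) ^ 2 * algebraMap R K A.det ^ (d + 1))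
    (j : Fin 2) : A.det ∣ ρ ^ 2 * A 1 j ^ (2 * (2 * d - 1)) := by
  have hinj := FaithfulSMul.algebraMap_injective R K
  obtain ⟨P1, P2⟩ := P
  obtain ⟨⟨F, hF⟩, ⟨G, hG⟩⟩ := hP
  dsimp only at hF hG h1 h2
  subst hF hG
  obtain ⟨⟨Q1, hQ1⟩, ⟨Q2, hQ2⟩⟩ := hg
  let v : Fin 2 → R := fun i => A i j
  have hev (F : MvPolynomial (Fin 2) R) : MvPolynomial.eval (Pi.single j 1)
      (substForm (A.map (algebraMap R K)) (MvPolynomial.map (algebraMap R K) F)) =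
      algebraMap R K (MvPolynomial.eval v F) := by
    rw [eval_substForm]
    exact eval_map_algebraMap v F
  have hev' (F : MvPolynomial (Fin 2) R) : MvPolynomial.eval (Pi.single j 1)
      (MvPolynomial.map (algebraMap R K) F) =
      algebraMap R K (MvPolynomial.eval (Pi.single j 1) F) := by
    rw [← eval_map_algebraMap]
    congr 2
    ext i
    rw [Pi.apply_single (fun _ => algebraMap R K) (by simp), map_one]
  rw [act_fst, hA] at hQ1
  rw [act_snd, hA] at hQ2
  have e1 := congrArg (MvPolynomial.eval (Pi.single j 1)) hQ1
  have e2 := congrArg (MvPolynomial.eval (Pi.single j 1)) hQ2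
  simp only [hev', map_mul, map_sub, map_add, map_neg, hev, MvPolynomial.eval_C,
    Matrix.map_apply] at e1 e2
  obtain ⟨a, b, hab⟩ := exists_eval_mul_add_eval_mul (by omega)
    (MvPolynomial.IsHomogeneous.of_map hinj h1) (MvPolynomial.IsHomogeneous.of_map hinj h2) hρ v
  generalize MvPolynomial.eval v F = x at *
  generalize MvPolynomial.eval v G = z at *
  generalize MvPolynomial.eval (Pi.single j 1) Q1 = q1 at *
  generalize MvPolynomial.eval (Pi.single j 1) Q2 = q2 at *
  have hdet := A.det_fin_two
  have hdetK := congrArg (algebraMap R K) hdet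
  simp only [map_sub, map_mul] at hdetK
  have hx : (g.1 : K) * algebraMap R K A.det * algebraMap R K x =
      algebraMap R K (A 0 0 * q1 + A 0 1 * q2) := by
    simp only [map_add, map_mul, e1, e2, hdetK]
    ring
  have hz : (g.1 : K) * algebraMap R K A.det * algebraMap R K z =
      algebraMap R K (A 1 0 * q1 + A 1 1 * q2) := by
    simp only [map_add, map_mul, e1, e2, hdetK]
    ring
  obtain ⟨k, rfl⟩ : ∃ k, d = k + 2 := ⟨d - 2, by omega⟩
  have hdvd {x z y t : R} (hx : (g.1 : K) * algebraMap R K A.det * algebraMap R K x =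
      algebraMap R K y) (hz : (g.1 : K) * algebraMap R K A.det * algebraMap R K z =
      algebraMap R K t) : A.det ∣ x * z := by
    rw [← Units.dvd_mul_left (u := w)]
    -- For d = k + 2, w x z = λ² det(A)^{k+3} x z = det(A)^{k+1} y t.
    refine ⟨A.det ^ k * (y * t), hinj ?_⟩
    simp only [map_mul, map_pow, ← hx, ← hz, hw]
    ring
  -- These are the terms of (xa + zb)², the square of ρ v₁^{2d-1}.
  have := ((hdvd hx hx).mul_right (a ^ 2)).add (((hdvd hx hz).mul_right (2 * a * b)).add
    ((hdvd hz hz).mul_right (b ^ 2)))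
  convert this using 1
  rw [pow_mul', ← mul_pow, ← hab]
  ring

end Divisibility
-- From congruent primitive matrices to equal cosets.
section Cosets

variable {R K : Type*} [CommRing R] [Field K] [Algebra R K]

/-- The exchange of the two variables. -/
noncomputable def swapTrans (K : Type*) [Field K] : Trans K :=
  (1, Matrix.GeneralLinearGroup.mkOfDetNeZero !![0, 1; 1, 0] (by simp))

lemma coe_swapTrans_snd :
    ((swapTrans K).2 : Matrix (Fin 2) (Fin 2) K) = !![0, 1; 1, 0] := rfl

lemma swapTrans_mul_swapTrans : swapTrans K * swapTrans K = 1 := by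
  refine Prod.ext (by simp [swapTrans]) (Units.ext ?_)
  rw [Prod.snd_mul, Units.val_mul, coe_swapTrans_snd]
  simp [Matrix.one_fin_two]

lemma swapTrans_mem_integralSubgroup : swapTrans K ∈ integralSubgroup R K := by
  have h : !![(0 : R), 1; 1, 0] * !![0, 1; 1, 0] = 1 := by simp [Matrix.one_fin_two]
  refine ⟨(1, ⟨_, _, h, h⟩), Prod.ext (by simp [swapTrans]) (Units.ext ?_)⟩
  rw [coe_swapTrans_snd]
  ext i j
  fin_cases i <;> fin_cases j <;> simp

lemma det_dvd_sq_of_isOver_act [FaithfulSMul R K] {d : ℕ} (hd : 2 ≤ d) {P : FormPair K}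
    (h1 : P.1.IsHomogeneous d)
    (h2 : P.2.IsHomogeneous d) (hP : IsOver R P) {ρ : R} (hρ : algebraMap R K ρ = res d P)
    {g : Trans K} {A : Matrix (Fin 2) (Fin 2) R}
    (hspan : Ideal.span (Set.range fun ij : Fin 2 × Fin 2 => A ij.1 ij.2) = ⊤)
    (hA : (g.2 : Matrix (Fin 2) (Fin 2) K) = A.map (algebraMap R K)) (hg : IsOver R (act P g))
    {w : Rˣ} (hw : algebraMap R K w = (g.1 : K) ^ 2 * algebraMap R K A.det ^ (d + 1)) :
    A.det ∣ ρ ^ 2 := by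
  have key : ∀ i j, A.det ∣ ρ ^ 2 * A i j ^ (2 * (2 * d - 1)) := by
    intro i j
    fin_cases i
    · have hS := isHomogeneous_act h1 h2 (swapTrans K)
      have hdet : (!![0, 1; 1, 0] * A).det = -A.det := by
        rw [Matrix.det_mul, Matrix.det_fin_two_of]
        ring
      -- The bound for the second row, applied to the swapped model and to A with its rows
      -- exchanged, gives the first row. The resultant is unchanged because d² + d is even.
      have h := det_dvd_of_isOver_act hd hS.1 hS.2
        (isOver_act R hP swapTrans_mem_integralSubgroup) (ρ := ρ) ?_
        (g := swapTrans K * g) (A := !![0, 1; 1, 0] * A) ?_ ?_ (w := (-1) ^ (d + 1) * w) ?_ j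
      · rw [hdet, neg_dvd] at h
        simpa [Matrix.mul_apply, Fin.sum_univ_two] using h
      · rw [hρ, res_act h1 h2, coe_swapTrans_snd, Matrix.det_fin_two_of,
          show d ^ 2 + d = d * (d + 1) by ring]
        simp [swapTrans, (Nat.even_mul_succ_self d).neg_one_pow]
      · rw [Prod.snd_mul, Units.val_mul, coe_swapTrans_snd, hA, Matrix.map_mul]
        congr 1
        ext i j
        fin_cases i <;> fin_cases j <;> simp
      · rwa [act_act, ← mul_assoc, swapTrans_mul_swapTrans, one_mul]
      · rw [hdet, Prod.fst_mul]
        simp only [swapTrans, one_mul, Units.val_mul, Units.val_pow_eq_pow_val, Units.val_neg,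
          Units.val_one, map_mul, hw, map_pow, map_neg, map_one]
        rw [neg_pow (algebraMap R K A.det)]
        ring
    · exact det_dvd_of_isOver_act hd h1 h2 hP hρ hA hg hw j
  -- Powers of generators of the unit ideal still generate it, so the factor A i j ^ (2(2d-1)) can
  -- be dropped.
  have htop := Ideal.span_pow_eq_top _ hspan (2 * (2 * d - 1))
  have hle : Ideal.span ((fun x => x ^ (2 * (2 * d - 1))) ''
      Set.range fun ij : Fin 2 × Fin 2 => A ij.1 ij.2) ≤
      Submodule.comap (LinearMap.mulLeft R (ρ ^ 2)) (Ideal.span {A.det}) := by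
    rw [Ideal.span_le]
    rintro _ ⟨_, ⟨ij, rfl⟩, rfl⟩
    exact Ideal.mem_span_singleton.mpr (key ij.1 ij.2)
  rw [htop] at hle
  have : ρ ^ 2 * 1 ∈ Ideal.span {A.det} := hle (Submodule.mem_top (x := (1 : R)))
  rwa [mul_one, Ideal.mem_span_singleton] at this

/-- Congruent matrices modulo a multiple of the determinant differ by an integral factor. -/
lemma exists_eq_mul_of_map_eq {r : R} {A B : Matrix (Fin 2) (Fin 2) R} (hA : A.det ∣ r)
    (h : A.map (Ideal.Quotient.mk (Ideal.span {r})) = B.map (Ideal.Quotient.mk (Ideal.span {r}))) :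
    ∃ V, B = A * V := by
  obtain ⟨s, rfl⟩ := hA
  have hdvd (i j) : ∃ c, B i j - A i j = A.det * s * c := by
    have := congrFun (congrFun h i) j
    rw [Matrix.map_apply, Matrix.map_apply, eq_comm, Ideal.Quotient.eq,
      Ideal.mem_span_singleton] at this
    exact this
  choose C hC using hdvd
  -- B = A + det(A) s C and det(A) = A · adj(A).
  refine ⟨1 + s • (A.adjugate * Matrix.of C), ?_⟩
  rw [mul_add, mul_one, mul_smul_comm, ← mul_assoc, Matrix.mul_adjugate, smul_mul_assoc, one_mul]
  ext i j
  simp only [Matrix.add_apply, Matrix.smul_apply, smul_eq_mul, Matrix.of_apply]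
  linear_combination hC i j

variable [IsDomain R] [IsPrincipalIdealRing R] [IsFractionRing R K]

/-- Each of A and B is a right multiple of the other, so B = AV with V invertible, as det A ≠ 0.
Dividing the two unit relations shows that the square of the quotient of the λ's is a unit, so the
quotient is one too. -/
lemma inv_mul_mem_integralSubgroup {d : ℕ} {r : R} {g h : Trans K}
    {A B : Matrix (Fin 2) (Fin 2) R}
    (hgA : (g.2 : Matrix (Fin 2) (Fin 2) K) = A.map (algebraMap R K))
    (hhB : (h.2 : Matrix (Fin 2) (Fin 2) K) = B.map (algebraMap R K)) {w z : Rˣ}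
    (hw : algebraMap R K w = (g.1 : K) ^ 2 * algebraMap R K A.det ^ (d + 1))
    (hz : algebraMap R K z = (h.1 : K) ^ 2 * algebraMap R K B.det ^ (d + 1))
    (hA : A.det ∣ r) (hB : B.det ∣ r)
    (hAB : A.map (Ideal.Quotient.mk (Ideal.span {r})) =
      B.map (Ideal.Quotient.mk (Ideal.span {r}))) : g⁻¹ * h ∈ integralSubgroup R K := by
  obtain ⟨V, hV⟩ := exists_eq_mul_of_map_eq hA hAB
  obtain ⟨W, hW⟩ := exists_eq_mul_of_map_eq hB hAB.symm
  have hdet : A.det ≠ 0 := by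
    intro h0
    rw [h0, map_zero, zero_pow (Nat.succ_ne_zero d), mul_zero] at hw
    exact w.ne_zero ((map_eq_zero_iff _ (IsFractionRing.injective R K)).mp hw)
  have hdetK : algebraMap R K A.det ≠ 0 :=
    (map_ne_zero_iff _ (IsFractionRing.injective R K)).mpr hdet
  have hVW : V * W = 1 := by
    have h1 : A * (V * W - 1) = 0 := by
      rw [mul_sub, mul_one, ← mul_assoc, ← hV, ← hW, sub_self]
    have h2 := congrArg (fun M => A.adjugate * M) h1
    simp only [← mul_assoc, Matrix.adjugate_mul, smul_mul_assoc, one_mul, mul_zero] at h2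
    exact sub_eq_zero.mp ((smul_eq_zero.mp h2).resolve_left hdet)
  let V' : GL (Fin 2) R := ⟨V, W, hVW, mul_eq_one_comm.mp hVW⟩
  let D : Rˣ := Matrix.GeneralLinearGroup.det V'
  have hD : (D : R) = V.det := rfl
  obtain ⟨l, hl⟩ := exists_unit_of_pow_eq (R := R) (x := ((g.1⁻¹ * h.1 : Kˣ) : K)) (n := 2)
    two_pos (u := w⁻¹ * z * (D⁻¹) ^ (d + 1)) (by
      have hw' : algebraMap R K ((w⁻¹ : Rˣ) : R) = ((g.1 : K) ^ 2 *
          algebraMap R K A.det ^ (d + 1))⁻¹ := by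
        rw [← hw]
        exact map_units_inv (algebraMap R K) w
      have hD' : algebraMap R K ((D⁻¹ : Rˣ) : R) = (algebraMap R K V.det)⁻¹ :=
        map_units_inv (algebraMap R K) D
      have hDne : algebraMap R K V.det ≠ 0 := by
        rw [← hD]
        exact (D.isUnit.map (algebraMap R K)).ne_zero
      have hg := g.1.ne_zero
      simp only [Units.val_mul, Units.val_pow_eq_pow_val, map_mul, map_pow, hw', hz, hD', hV,
        Matrix.det_mul, Units.val_inv_eq_inv_val]
      rw [mul_pow, mul_pow]
      field_simp
      rw [one_div, ← mul_pow, mul_inv_cancel₀ hDne, one_pow])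
  refine ⟨(l, V'), Prod.ext (Units.ext hl) ?_⟩
  rw [Prod.snd_mul, Prod.snd_inv, eq_inv_mul_iff_mul_eq]
  refine Units.ext ?_
  rw [Units.val_mul, hgA, hhB, hV, Matrix.map_mul]
  rfl

lemma exists_primitive_mul_scalarHom (d : ℕ) (g : Trans K) :
    ∃ (t : Kˣ) (A : Matrix (Fin 2) (Fin 2) R),
      Ideal.span (Set.range fun ij : Fin 2 × Fin 2 => A ij.1 ij.2) = ⊤ ∧
      ((g * scalarHom d K t).2 : Matrix (Fin 2) (Fin 2) K) = A.map (algebraMap R K) := by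
  obtain ⟨c, A, hA, hg⟩ := exists_primitive_multiple (R := R) g.2
  refine ⟨c⁻¹, A, hA, ?_⟩
  have hs : ((scalarHom d K c⁻¹).2 : Matrix (Fin 2) (Fin 2) K) =
    Matrix.scalar (Fin 2) ((c⁻¹ : Kˣ) : K) := rfl
  rw [Prod.snd_mul, Units.val_mul, hg, hs]
  ext i j
  simp [mul_comm]

end Cosets

end MinimalModels

/-! ### The finiteness theorem. -/

theorem mainTheorem7 (R K : Type*) [CommRing R] [Field K] [Algebra R K]
    (hRK : MinimalModels.IsRingOfIntegersOfGlobalField R K) [IsPrincipalIdealRing R]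
    (d : ℕ) (hd : 2 ≤ d) (P : MinimalModels.FormPair K)
    (hP : MinimalModels.IsMinimalModel R d P) :
    ∃ s : Finset (MinimalModels.Trans K),
      MinimalModels.minTran R d P =
        ⋃ g ∈ s, g • ((MinimalModels.integralSubgroup R K ⊔ MinimalModels.scalarSubgroup d K :
          Subgroup (MinimalModels.Trans K)) : Set (MinimalModels.Trans K)) := by
  open MinimalModels in
  obtain ⟨hR, hfrac, hfin⟩ := hRK.properties
  obtain ⟨ρ, hρ, -⟩ := hP.2.2.2
  have hρ0 : ρ ≠ 0 := by
    rintro rfl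
    exact hP.1.2.2 (by rw [← hρ, map_zero])
  have : Finite (R ⧸ Ideal.span {ρ ^ 2}) :=
    hfin.finiteQuotient (by simpa using hρ0)
  have : Finite (Matrix (Fin 2) (Fin 2) (R ⧸ Ideal.span {ρ ^ 2})) :=
    inferInstanceAs (Finite (Fin 2 → Fin 2 → R ⧸ Ideal.span {ρ ^ 2}))
  have hscalar := fun g hg h hh =>
    mul_mem_minTran_of_mem_scalarSubgroup (R := R) hP.1 (g := g) (h := h) hg hh
  refine exists_finset_eq_iUnion_smul _ _
    (mul_mem_of_mem_sup (fun g hg h hh => mul_mem_minTran_of_mem_integralSubgroup hP hg hh)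
      hscalar)
    -- The label of g is the residue modulo ρ² of a primitive multiple of its matrix. That multiple
    -- is fixed only up to units of R, so labelling is a relation rather than a function.
    (fun g M => ∃ (t : Kˣ) (A : Matrix (Fin 2) (Fin 2) R),
      Ideal.span (Set.range fun ij : Fin 2 × Fin 2 => A ij.1 ij.2) = ⊤ ∧
      ((g * scalarHom d K t).2 : Matrix (Fin 2) (Fin 2) K) = A.map (algebraMap R K) ∧
      A.map (Ideal.Quotient.mk (Ideal.span {ρ ^ 2})) = M) ?_ ?_
  · intro g _
    obtain ⟨t, A, hA, hgA⟩ := exists_primitive_mul_scalarHom (R := R) d g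
    exact ⟨_, t, A, hA, hgA, rfl⟩
  · rintro g hg h hh _ ⟨t, A, hA, hgA, rfl⟩ ⟨t', B, hB, hhB, hAB⟩
    have key {g : Trans K} (hg : g ∈ minTran R d P) {t : Kˣ} {A : Matrix (Fin 2) (Fin 2) R}
        (hA : Ideal.span (Set.range fun ij : Fin 2 × Fin 2 => A ij.1 ij.2) = ⊤)
        (hgA : ((g * scalarHom d K t).2 : Matrix (Fin 2) (Fin 2) K) = A.map (algebraMap R K)) :
        A.det ∣ ρ ^ 2 ∧ ∃ w : Rˣ, algebraMap R K w =
          ((g * scalarHom d K t).1 : K) ^ 2 * algebraMap R K A.det ^ (d + 1) := by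
      have hgt := hscalar g hg _ ⟨t, rfl⟩
      rw [mem_minTran_iff hP] at hgt
      obtain ⟨hover, u, hu⟩ := hgt
      obtain ⟨w, hw⟩ := exists_unit_sq_mul_det_pow (by omega) hu
      have hdet : (A.map (algebraMap R K)).det = algebraMap R K A.det :=
        (RingHom.map_det (algebraMap R K) A).symm
      rw [hgA, hdet] at hw
      exact ⟨det_dvd_sq_of_isOver_act hd hP.1.1 hP.1.2.1 hP.2.2.1 hρ hA hgA hover hw, w, hw⟩
    obtain ⟨hAρ, w, hw⟩ := key hg hA hgA
    obtain ⟨hBρ, z, hz⟩ := key hh hB hhB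
    have hmem := inv_mul_mem_integralSubgroup hgA hhB hw hz hAρ hBρ hAB.symm
    rw [show g⁻¹ * h = scalarHom d K t * ((g * scalarHom d K t)⁻¹ * (h * scalarHom d K t')) *
      (scalarHom d K t')⁻¹ by group]
    exact mul_mem (mul_mem (Subgroup.mem_sup_right ⟨t, rfl⟩) (Subgroup.mem_sup_left hmem))
      (inv_mem (Subgroup.mem_sup_right ⟨t', rfl⟩))
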